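/- Let $\mathcal K$ be a small (strict) 2-category and write $y(C)=\mathcal K(-,C)$. For pseudofunctors $F,G\colon\mathcal K^{\mathrm{op}}\to\mathbf{Cat}$, write $\mathrm{Hom}(F,G)$ for the category of pseudonatural transformations $F\Rightarrow G$ and modifications. A \emph{bisieve} over $C\in\mathcal K$ is a fully faithful morphism $S\colon R\Rightarrow y(C)$ in the bicategory of pseudofunctors $\mathcal K^{\mathrm{op}}\to\mathbf{Cat}$, pseudonatural transformations and modifications. A \emph{bitopology} $\tau$ on $\mathcal K$ assigns to every $C$ a collection $\tau(C)$ of bisieves over $C$ (the \emph{covering} bisieves) such that: (T1) the identity of $y(C)$ is in $\tau(C)$; (T2) for $S\colon R\Rightarrow y(C)$ in $\tau(C)$ and $f\colon D\to C$ there is a bi-iso-comma object $P$ of $f\circ-\colon y(D)\Rightarrow y(C)$ and $S$ whose projection $P\Rightarrow y(D)$ is in $\tau(D)$; (T3) if $S'\colon R'\Rightarrow y(C)$ is in $\tau(C)$ and $S\colon R\Rightarrow y(C)$ is a bisieve such that for every $D$ and every $x\in R'(D)$, with $f=S'_D(x)\colon D\to C$, there is a bi-iso-comma object of $f\circ-$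 and $S$ whose projection to $y(D)$ is in $\tau(D)$, then $S$ is equivalent (over $y(C)$) to a bisieve in $\tau(C)$. A pseudofunctor $F\colon\mathcal K^{\mathrm{op}}\to\mathbf{Cat}$ is a \emph{stack} for $\tau$ if for every $C$ and every $S\colon R\Rightarrow y(C)$ in $\tau(C)$ the functor $-\circ S\colon \mathrm{Hom}(y(C),F)\to\mathrm{Hom}(R,F)$ is an equivalence of categories; $\tau$ is \emph{subcanonical} if every representable $\mathcal K(-,D)$ is a stack. For a pseudofunctor $R\colon\mathcal K^{\mathrm{op}}\to\mathbf{Cat}$ let $\int R$ be the 2-category of elements: its objects are pairs $(D,x)$ with $x\in R(D)$, its morphisms $(E,x')\to(D,x)$ are pairs $(g,\alpha)$ with $g\colon E\to D$ and $\alpha\colon x'\to R(g)(x)$, and its 2-cells $(g,\alpha)\Rightarrow(g',\beta)$ are the 2-cells $\delta\colon g\Rightarrow g'$ with $R(\delta)_x\circ\alpha=\beta$. A \emph{sigma natural transformation} between pseudofunctors $(\int R)^{\mathrm{op}}\to\mathbf{Cat}$ is an oplax natural transformation whose structure 2-cell on each $(g,\alpha)$ with $\alpha$ invertible is invertible. An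 object $C$ is the \emph{sigma-bicolimit} of a pseudofunctor $F\colon\int R\to\mathcal K$ if there is an equivalence of categories, pseudonatural in $D\in\mathcal K$, $$\mathcal K(C,D)\;\simeq\;\sigma\big(\Delta 1,\ \mathcal K(F(-),D)\big),$$ where $\Delta1$ is constant at the terminal category and the right-hand side is the category of sigma natural transformations and modifications. \textbf{Theorem.} Let $\tau$ be a subcanonical bitopology on $\mathcal K$ and let $S\colon R\Rightarrow y(C)$ be a covering bisieve over $C\in\mathcal K$. Then $S$ is a sigma-bicolim bisieve, i.e. $C$ is the sigma-bicolimit of the projection 2-functor $\int R\to\mathcal K$, $(D,x)\mapsto D$. -/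

import Mathlib

open CategoryTheory Bicategory Opposite Bicategory.Opposite

universe u w₁ v₁ u₁ w₂ v₂ u₂

namespace Bisite

/-! ### The 2-category of elements of a pseudofunctor `W : Aᵒᵖ ⥤ᵖ Cat` -/

/-- Objects of the 2-category of elements `∫ W`: pairs `(a, x)` with `x` an object of `W a`. -/
structure Elements {A : Type u₁} [Bicategory.{w₁, v₁} A] (W : Aᵒᵖ ⥤ᵖ Cat.{v₂, u₂}) where
  base : A
  fiber : W.obj (op base)

namespace Elements

variable {A : Type u₁} [Bicategory.{w₁, v₁} A] {W : Aᵒᵖ ⥤ᵖ Cat.{v₂, u₂}}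

/-- Morphisms `(a, x) ⟶ (b, y)` of `∫ W`: pairs `(g, α)` with `g : a ⟶ b` and
`α : x ⟶ W(g)(y)`. -/
structure Hom (X Y : Elements W) where
  base : X.base ⟶ Y.base
  fiber : X.fiber ⟶ (W.map base.op).toFunctor.obj Y.fiber

@[simps]
instance categoryStruct : CategoryStruct (Elements W) where
  Hom X Y := Hom X Y
  id X :=
    { base := 𝟙 X.base
      fiber := (W.mapId (op X.base)).inv.toNatTrans.app X.fiber }
  comp {_ _ Z} f g :=
    { base := f.base ≫ g.base
      fiber := f.fiber ≫ (W.map f.base.op).toFunctor.map g.fiber ≫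
        (W.mapComp g.base.op f.base.op).inv.toNatTrans.app Z.fiber }

/-- 2-cells `(g, α) ⟶ (g', β)` of `∫ W`: 2-cells `δ : g ⟶ g'` of `A` with
`α ≫ W(δ)_y = β`. -/
@[ext]
structure Hom₂ {X Y : Elements W} (f g : X ⟶ Y) where
  cell : f.base ⟶ g.base
  w : f.fiber ≫ (W.map₂ (op2 cell)).toNatTrans.app Y.fiber = g.fiber

attribute [simp] Hom₂.w

@[simps]
instance homCategory (X Y : Elements W) : Category (X ⟶ Y) where
  Hom f g := Hom₂ f g
  id f := { cell := 𝟙 f.base, w := by simp }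
  comp η θ := { cell := η.cell ≫ θ.cell, w := by simp [← Category.assoc] }

@[ext]
lemma hom₂_ext {X Y : Elements W} {f g : X ⟶ Y} {η θ : f ⟶ g} (h : η.cell = θ.cell) : η = θ :=
  Hom₂.ext h

lemma isoMk_aux {X Y : Elements W} {f g : X ⟶ Y} (e : f.base ≅ g.base)
    (w : f.fiber ≫ (W.map₂ (op2 e.hom)).toNatTrans.app Y.fiber = g.fiber) : 
    g.fiber ≫ (W.map₂ (op2 e.inv)).toNatTrans.app Y.fiber = f.fiber := by
  rw [← w, Category.assoc, ← Cat.Hom₂.comp_app, ← W.map₂_comp, ← op2_comp]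
  simp

/-- An invertible 2-cell of `A` compatible with the fibers is an invertible 2-cell of `∫ W`. -/
@[simps]
def isoMk {X Y : Elements W} {f g : X ⟶ Y} (e : f.base ≅ g.base)
    (w : f.fiber ≫ (W.map₂ (op2 e.hom)).toNatTrans.app Y.fiber = g.fiber) : f ≅ g where
  hom := ⟨e.hom, w⟩
  inv := ⟨e.inv, isoMk_aux e w⟩


lemma whiskerLeft_w {X Y Z : Elements W} (f : X ⟶ Y) {g h : Y ⟶ Z} (η : Hom₂ g h) :
    (f ≫ g).fiber ≫ (W.map₂ (op2 (f.base ◁ η.cell))).toNatTrans.app Z.fiber = (f ≫ h).fiber := by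
  have e : op2 (f.base ◁ η.cell) = op2 η.cell ▷ f.base.op := rfl
  rw [e, Pseudofunctor.map₂_whisker_right_app]
  simp only [categoryStruct_comp_fiber, Category.assoc]
  erw [Cat.Hom.inv_hom_id_toNatTrans_app_assoc]
  rw [← Functor.map_comp_assoc, η.w]

lemma whiskerRight_w {X Y Z : Elements W} {f g : X ⟶ Y} (η : Hom₂ f g) (h : Y ⟶ Z) :
    (f ≫ h).fiber ≫ (W.map₂ (op2 (η.cell ▷ h.base))).toNatTrans.app Z.fiber = (g ≫ h).fiber := by
  have e : op2 (η.cell ▷ h.base) = h.base.op ◁ op2 η.cell := rfl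
  rw [e, Pseudofunctor.map₂_whisker_left_app]
  simp only [categoryStruct_comp_fiber, Category.assoc]
  erw [Cat.Hom.inv_hom_id_toNatTrans_app_assoc]
  rw [← η.w, NatTrans.naturality_assoc, Category.assoc]

lemma associator_w {X Y Z T : Elements W} (f : X ⟶ Y) (g : Y ⟶ Z) (h : Z ⟶ T) :
    ((f ≫ g) ≫ h).fiber ≫ (W.map₂ (op2 (α_ f.base g.base h.base).hom)).toNatTrans.app T.fiber =
      (f ≫ g ≫ h).fiber := by
  have e : op2 (α_ f.base g.base h.base).hom = (α_ h.base.op g.base.op f.base.op).inv := rfl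
  have key := Pseudofunctor.mapComp_assoc_left_inv_app W h.base.op g.base.op f.base.op T.fiber
  have nat := (W.mapComp g.base.op f.base.op).inv.toNatTrans.naturality h.fiber
  simp only [Cat.Hom.comp_map] at nat
  simp only [categoryStruct_comp_fiber, categoryStruct_comp_base, op_comp, e,
    Functor.map_comp, Category.assoc]
  erw [key, ← reassoc_of% nat]

lemma leftUnitor_w {X Y : Elements W} (f : X ⟶ Y) :
    (𝟙 X ≫ f).fiber ≫ (W.map₂ (op2 (λ_ f.base).hom)).toNatTrans.app Y.fiber = f.fiber := by
  have e : op2 (λ_ f.base).hom = (ρ_ f.base.op).hom := rfl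
  have nat := (W.mapId (op X.base)).inv.toNatTrans.naturality f.fiber
  rw [e, Pseudofunctor.map₂_right_unitor_app]
  simp only [categoryStruct_comp_fiber, Category.assoc]
  erw [Cat.Hom.inv_hom_id_toNatTrans_app_assoc, ← reassoc_of% nat,
    Cat.Hom.inv_hom_id_toNatTrans_app]
  exact Category.comp_id _

lemma rightUnitor_w {X Y : Elements W} (f : X ⟶ Y) :
    (f ≫ 𝟙 Y).fiber ≫ (W.map₂ (op2 (ρ_ f.base).hom)).toNatTrans.app Y.fiber = f.fiber := by
  have e : op2 (ρ_ f.base).hom = (λ_ f.base.op).hom := rfl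
  rw [e, Pseudofunctor.map₂_left_unitor_app]
  simp only [categoryStruct_comp_fiber, Category.assoc]
  erw [Cat.Hom.inv_hom_id_toNatTrans_app_assoc]
  rw [← Functor.map_comp]
  erw [Cat.Hom.inv_hom_id_toNatTrans_app, CategoryTheory.Functor.map_id]
  exact Category.comp_id _

@[simps! whiskerLeft_cell whiskerRight_cell]
instance : Bicategory (Elements W) where
  homCategory := homCategory
  whiskerLeft {X Y Z} f g h (η : Hom₂ g h) := ⟨f.base ◁ η.cell, whiskerLeft_w f η⟩
  whiskerRight {X Y Z f g} (η : Hom₂ f g) h := ⟨η.cell ▷ h.base, whiskerRight_w η h⟩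
  associator f g h := isoMk (α_ f.base g.base h.base) (associator_w f g h)
  leftUnitor f := isoMk (λ_ f.base) (leftUnitor_w f)
  rightUnitor f := isoMk (ρ_ f.base) (rightUnitor_w f)
  whisker_exchange _ _ := by ext; simp [whisker_exchange]

section
variable (W)

/-- The projection 2-functor `∫ W ⥤ A` to the first component. -/
@[simps!]
def proj : StrictPseudofunctor (Elements W) A where
  obj X := X.base
  map f := f.base
  map₂ η := η.cell
  mapId _ := Iso.refl _
  mapComp _ _ := Iso.refl _
end

/-- Equality of morphisms of `∫ W`, with the transport written as a 2-cell. -/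
lemma hom_ext {X Y : Elements W} {f g : X ⟶ Y} (h : f.base = g.base)
    (h' : f.fiber ≫ (W.map₂ (op2 (eqToHom h))).toNatTrans.app Y.fiber = g.fiber) : f = g := by
  obtain ⟨f, f'⟩ := f
  obtain ⟨g, g'⟩ := g
  obtain rfl : f = g := h
  obtain rfl : f' = g' := by simpa using h'
  rfl

lemma eqToIso_cell {X Y : Elements W} {f g : X ⟶ Y} (h : f = g) :
    (eqToIso h).hom.cell = (eqToIso (congrArg Hom.base h)).hom := by subst h; rfl

/-- If `A` is a strict 2-category then so is `∫ W`. -/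
instance [Bicategory.Strict A] : Bicategory.Strict (Elements W) where
  id_comp f := hom_ext (Strict.id_comp _) (by
    have := leftUnitor_w f
    rwa [Strict.leftUnitor_eqToIso] at this)
  comp_id f := hom_ext (Strict.comp_id _) (by
    have := rightUnitor_w f
    rwa [Strict.rightUnitor_eqToIso] at this)
  assoc f g h := hom_ext (Strict.assoc _ _ _) (by
    have := associator_w f g h
    rwa [Strict.associator_eqToIso] at this)
  leftUnitor_eqToIso f := by
    ext
    exact (congrArg Iso.hom (Strict.leftUnitor_eqToIso f.base)).trans (eqToIso_cell (f := 𝟙 _ ≫ f) (g := f) _).symm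
  rightUnitor_eqToIso f := by
    ext
    exact (congrArg Iso.hom (Strict.rightUnitor_eqToIso f.base)).trans (eqToIso_cell (f := f ≫ 𝟙 _) (g := f) _).symm
  associator_eqToIso f g h := by
    ext
    exact (congrArg Iso.hom (Strict.associator_eqToIso f.base g.base h.base)).trans
      (eqToIso_cell (f := (f ≫ g) ≫ h) (g := f ≫ g ≫ h) _).symm

end Elements

section Op
variable {B : Type u₁} [Bicategory.{w₁, v₁} B] {C : Type u₂} [Bicategory.{w₂, v₂} C]

/-- The pseudofunctor `Bᵒᵖ ⥤ᵖ Cᵒᵖ` induced by `F : B ⥤ᵖ C`. -/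
@[simps!]
def opPseudofunctor (F : B ⥤ᵖ C) : Bᵒᵖ ⥤ᵖ Cᵒᵖ where
  obj X := op (F.obj X.unop)
  map f := (F.map f.unop).op
  map₂ η := op2 (F.map₂ η.unop2)
  mapId X := (F.mapId X.unop).op2
  mapComp f g := (F.mapComp g.unop f.unop).op2
  map₂_associator f g h := congrArg op2 <| by
    change F.map₂ (α_ h.unop g.unop f.unop).inv =
      (F.mapComp h.unop (g.unop ≫ f.unop)).hom ≫ F.map h.unop ◁ (F.mapComp g.unop f.unop).hom ≫
        (α_ _ _ _).inv ≫ (F.mapComp h.unop g.unop).inv ▷ F.map f.unop ≫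
          (F.mapComp (h.unop ≫ g.unop) f.unop).inv
    rw [F.mapComp_assoc_right_hom_assoc]
    simp

/-- The constant pseudofunctor at `X`. -/
@[simps!]
def constPseudofunctor (B : Type u₁) [Bicategory.{w₁, v₁} B] (X : C) : B ⥤ᵖ C where
  obj _ := X
  map _ := 𝟙 X
  map₂ _ := 𝟙 _
  mapId _ := Iso.refl _
  mapComp _ _ := (λ_ (𝟙 X)).symm

end Op


section Corep

variable {B : Type u₁} [Bicategory.{w₁, v₁} B]

/-- The covariant representable pseudofunctor `B(a, -) : B ⥤ᵖ Cat`. -/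
@[simps! toPrelaxFunctor mapId mapComp]
def corepresentable (a : B) : B ⥤ᵖ Cat.{w₁, v₁} where
  toPrelaxFunctor := PrelaxFunctor.mkOfHomFunctors (fun b => Cat.of (a ⟶ b))
    (fun b c => postcomposingCat a b c)
  mapId b := rightUnitorNatIsoCat a b
  mapComp f g := (associatorNatIsoLeftCat a f g).symm
  map₂_whisker_left f g h η := by
    ext x
    revert x
    change ∀ x : a ⟶ _, x ◁ (f ◁ η) = (α_ x f g).inv ≫ (x ≫ f) ◁ η ≫ (α_ x f h).hom
    intro x
    simp
  map₂_whisker_right {_ _ _ f g} η h := by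
    ext x
    revert x
    change ∀ x : a ⟶ _, x ◁ (η ▷ h) = (α_ x f h).inv ≫ (x ◁ η) ▷ h ≫ (α_ x g h).hom
    intro x
    simp
  map₂_associator f g h := by
    ext x
    revert x
    change ∀ x : a ⟶ _, x ◁ (α_ f g h).hom = (α_ x (f ≫ g) h).inv ≫ (α_ x f g).inv ▷ h ≫ 𝟙 _ ≫
      (α_ (x ≫ f) g h).hom ≫ (α_ x f (g ≫ h)).hom
    intro x
    simp
  map₂_left_unitor f := by
    ext x
    revert x
    change ∀ x : a ⟶ _, x ◁ (λ_ f).hom = (α_ x (𝟙 _) f).inv ≫ (ρ_ x).hom ▷ f ≫ 𝟙 _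
    intro x
    simp
  map₂_right_unitor f := by
    ext x
    revert x
    change ∀ x : a ⟶ _, x ◁ (ρ_ f).hom = (α_ x f (𝟙 _)).inv ≫ (ρ_ (x ≫ f)).hom ≫ 𝟙 _
    intro x
    simp

variable (G : B ⥤ᵖ Cat.{v₂, u₂}) (P : ∀ b : B, ObjectProperty (G.obj b))
  (hP : ∀ {b c : B} (f : b ⟶ c) (x : G.obj b), P b x → P c ((G.map f).toFunctor.obj x))

/-- Given `G : B ⥤ᵖ Cat` and full subcategories of the `G b` stable under the functors `G f`,
the pseudofunctor `B ⥤ᵖ Cat` that these full subcategories form. -/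
def fullSubPseudofunctor : B ⥤ᵖ Cat.{v₂, u₂} where
  obj b := Cat.of (P b).FullSubcategory
  map {b c} f := ((P c).lift ((P b).ι ⋙ (G.map f).toFunctor)
    (fun x => hP f x.obj x.property)).toCatHom
  map₂ {b c f g} η := NatTrans.toCatHom₂
    { app x := ObjectProperty.homMk ((G.map₂ η).toNatTrans.app x.obj)
      naturality x y k := by
        ext
        exact (G.map₂ η).toNatTrans.naturality k.hom }
  map₂_id f := by
    ext x
    refine ObjectProperty.hom_ext _ ?_
    exact congrArg (fun k => k.toNatTrans.app x.obj) (G.map₂_id f)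
  map₂_comp η θ := by
    ext x
    refine ObjectProperty.hom_ext _ ?_
    exact congrArg (fun k => k.toNatTrans.app x.obj) (G.map₂_comp η θ)
  mapId b := Cat.Hom.isoMk <| NatIso.ofComponents
    (fun x => (P b).isoMk ((Cat.Hom.toNatIso (G.mapId b)).app x.obj))
    (fun k => by
      ext
      exact (G.mapId b).hom.toNatTrans.naturality k.hom)
  mapComp {b c d} f g := Cat.Hom.isoMk <| NatIso.ofComponents
    (fun x => (P d).isoMk ((Cat.Hom.toNatIso (G.mapComp f g)).app x.obj))
    (fun k => by
      ext
      exact (G.mapComp f g).hom.toNatTrans.naturality k.hom)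
  map₂_whisker_left f _ _ η := by
    ext x
    refine ObjectProperty.hom_ext _ ?_
    exact congrArg (fun k => k.toNatTrans.app x.obj) (G.map₂_whisker_left f η)
  map₂_whisker_right η h := by
    ext x
    refine ObjectProperty.hom_ext _ ?_
    exact congrArg (fun k => k.toNatTrans.app x.obj) (G.map₂_whisker_right η h)
  map₂_associator f g h := by
    ext x
    refine ObjectProperty.hom_ext _ ?_
    exact congrArg (fun k => k.toNatTrans.app x.obj) (G.map₂_associator f g h)
  map₂_left_unitor f := by
    ext x
    refine ObjectProperty.hom_ext _ ?_
    exact congrArg (fun k => k.toNatTrans.app x.obj) (G.map₂_left_unitor f)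
  map₂_right_unitor f := by
    ext x
    refine ObjectProperty.hom_ext _ ?_
    exact congrArg (fun k => k.toNatTrans.app x.obj) (G.map₂_right_unitor f)

end Corep

section Sigma

open scoped Oplax.OplaxTrans Oplax.OplaxTrans.OplaxFunctor

variable {A : Type u} [Bicategory.{u, u} A] {W : Aᵒᵖ ⥤ᵖ Cat.{u, u}}
variable {K : Type u} [Bicategory.{u, u} K]

/-! ### Sigma natural transformations and sigma-bicolimits -/

/-- An oplax natural transformation between pseudofunctors `(∫ W)ᵒᵖ ⥤ᵖ Cat` is a sigma natural
transformation if its structure 2-cell at every morphism `(g, α)` of `∫ W` with `α` invertible is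
invertible. -/
def IsSigma {M N : (Elements W)ᵒᵖ ⥤ᵖ Cat.{u, u}} :
    ObjectProperty (M.toOplax ⟶ N.toOplax) := fun γ =>
  ∀ ⦃X Y : Elements W⦄ (f : X ⟶ Y), IsIso f.fiber → IsIso (γ.naturality f.op)

/-- The pseudofunctor `K(F(-), D) : (∫ W)ᵒᵖ ⥤ᵖ Cat`. -/
def homInto (F : Elements W ⥤ᵖ K) (D : K) : (Elements W)ᵒᵖ ⥤ᵖ Cat.{u, u} :=
  (opPseudofunctor F).comp (yoneda₀ D)

/-- The constant pseudofunctor `Δ1 : (∫ W)ᵒᵖ ⥤ᵖ Cat` at the terminal category. -/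
def delta (W : Aᵒᵖ ⥤ᵖ Cat.{u, u}) : (Elements W)ᵒᵖ ⥤ᵖ Cat.{u, u} :=
  constPseudofunctor _ (Cat.of (Discrete PUnit.{u + 1}))

/-- Postcomposition with `r : D ⟶ E`, as a transformation `K(F(-), D) ⟶ K(F(-), E)`. -/
def homIntoMap (F : Elements W ⥤ᵖ K) {D E : K} (r : D ⟶ E) :
    (homInto F D).toOplax ⟶ (homInto F E).toOplax where
  app X := (postcomposingCat (F.obj X.unop) D E).obj r
  naturality f := (associatorNatIsoMiddleCat (F.map f.unop) r).hom
  naturality_naturality {X Y f g} η := by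
    ext y
    revert y
    change ∀ y : F.obj X.unop ⟶ D, (F.map₂ η.unop2 ▷ y) ▷ r ≫ (α_ (F.map g.unop) y r).hom =
      (α_ (F.map f.unop) y r).hom ≫ F.map₂ η.unop2 ▷ (y ≫ r)
    intro y
    simp
  naturality_id X := by
    ext y
    revert y
    change ∀ y : F.obj X.unop ⟶ D, (α_ (F.map (𝟙 X.unop)) y r).hom ≫ (F.mapId X.unop).hom ▷ (y ≫ r) ≫ (λ_ (y ≫ r)).hom =
      ((F.mapId X.unop).hom ▷ y ≫ (λ_ y).hom) ▷ r ≫ 𝟙 _ ≫ 𝟙 _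
    intro y
    simp
  naturality_comp {X Y Z} f g := by
    ext y
    revert y
    change ∀ y : F.obj X.unop ⟶ D, (α_ (F.map (g.unop ≫ f.unop)) y r).hom ≫
        (F.mapComp g.unop f.unop).hom ▷ (y ≫ r) ≫ (α_ _ _ _).hom =
      ((F.mapComp g.unop f.unop).hom ▷ y ≫ (α_ _ _ _).hom) ▷ r ≫ 𝟙 _ ≫
        (α_ (F.map g.unop) (F.map f.unop ≫ y) r).hom ≫ 𝟙 _ ≫
          F.map g.unop ◁ (α_ (F.map f.unop) y r).hom ≫ 𝟙 _
    intro y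
    simp

/-- Postcomposition with a 2-cell, as a modification. -/
def homIntoMap₂ (F : Elements W ⥤ᵖ K) {D E : K} {r s : D ⟶ E} (η : r ⟶ s) :
    homIntoMap F r ⟶ homIntoMap F s where
  as :=
    { app X := (postcomposingCat (F.obj X.unop) D E).map η
      naturality {X Y} f := by
        ext y
        revert y
        change ∀ y : F.obj X.unop ⟶ D, (F.map f.unop ≫ y) ◁ η ≫ (α_ (F.map f.unop) y s).hom =
          (α_ (F.map f.unop) y r).hom ≫ F.map f.unop ◁ y ◁ η
        intro y
        simp }




/-- The pseudofunctor `D ↦ K(F(-), D)`, with values in the bicategory of oplax functors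
`(∫ W)ᵒᵖ ⥤ Cat`, oplax transformations and modifications. -/
def homIntoPseudofunctor (F : Elements W ⥤ᵖ K) : K ⥤ᵖ ((Elements W)ᵒᵖ ⥤ᵒᵖᴸ Cat.{u, u}) where
  obj D := (homInto F D).toOplax
  map r := homIntoMap F r
  map₂ η := homIntoMap₂ F η
  map₂_id r := by
    ext X : 1
    exact (corepresentable (F.obj X.unop)).map₂_id r
  map₂_comp η θ := by
    ext X : 1
    exact (corepresentable (F.obj X.unop)).map₂_comp η θ
  mapId D := Oplax.OplaxTrans.isoMk (fun X => (corepresentable (F.obj X.unop)).mapId D) (by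
    intro X Y f
    ext y
    revert y
    change ∀ y : F.obj X.unop ⟶ D, (ρ_ (F.map f.unop ≫ y)).hom ≫ 𝟙 _ ≫ 𝟙 _ =
      (α_ (F.map f.unop) y (𝟙 _)).hom ≫ F.map f.unop ◁ (ρ_ y).hom
    intro y
    simp)
  mapComp {D E G} r s := Oplax.OplaxTrans.isoMk
    (fun X => (corepresentable (F.obj X.unop)).mapComp r s) (by
    intro X Y f
    ext y
    revert y
    change ∀ y : F.obj X.unop ⟶ D, (α_ (F.map f.unop ≫ y) r s).inv ≫ 𝟙 _ ≫ (α_ (F.map f.unop) y r).hom ▷ s ≫ 𝟙 _ ≫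
        (α_ (F.map f.unop) (y ≫ r) s).hom ≫ 𝟙 _ =
      (α_ (F.map f.unop) y (r ≫ s)).hom ≫ F.map f.unop ◁ (α_ y r s).inv
    intro y
    simp)
  map₂_whisker_left f _ _ η := by
    ext X : 1
    exact (corepresentable (F.obj X.unop)).map₂_whisker_left f η
  map₂_whisker_right η h := by
    ext X : 1
    exact (corepresentable (F.obj X.unop)).map₂_whisker_right η h
  map₂_associator f g h := by
    ext X : 1
    exact (corepresentable (F.obj X.unop)).map₂_associator f g h
  map₂_left_unitor f := by
    ext X : 1
    exact (corepresentable (F.obj X.unop)).map₂_left_unitor f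
  map₂_right_unitor f := by
    ext X : 1
    exact (corepresentable (F.obj X.unop)).map₂_right_unitor f

lemma isIso_comp_naturality {B : Type u₁} [Bicategory.{w₁, v₁} B] {C : Type u₂}
    [Bicategory.{w₂, v₂} C] {F G H : B ⥤ᵒᵖᴸ C} (η : F ⟶ G) (θ : G ⟶ H) {a b : B} (f : a ⟶ b)
    (h₁ : IsIso (η.naturality f)) (h₂ : IsIso (θ.naturality f)) :
    IsIso ((η ≫ θ).naturality f) := by
  exact Iso.isIso_hom ((α_ _ _ _).symm ≪≫
    whiskerRightIso (@asIso _ _ _ _ (η.naturality f) h₁) (θ.app b) ≪≫ α_ _ _ _ ≪≫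
    whiskerLeftIso (η.app a) (@asIso _ _ _ _ (θ.naturality f) h₂) ≪≫ (α_ _ _ _).symm)

/-- The pseudofunctor `K ⥤ᵖ Cat` that sends `D` to the category of sigma natural transformations
`Δ1 ⟶ K(F(-), D)` and modifications, and acts by postcomposition. -/
def sigmaBicocones (F : Elements W ⥤ᵖ K) : K ⥤ᵖ Cat.{u, u} :=
  fullSubPseudofunctor
    ((homIntoPseudofunctor F).comp (corepresentable (delta W).toOplax))
    (fun D => IsSigma (M := delta W) (N := homInto F D)) (by
      intro D E r γ hγ X Y f hf
      exact isIso_comp_naturality γ (homIntoMap F r) f.op (hγ f hf)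
        (Iso.isIso_hom (associatorNatIsoMiddleCat (F.map f) r)))

open scoped Pseudofunctor.StrongTrans

/-- `C` is the sigma-bicolimit of `F : ∫ W ⥤ᵖ K`: there is a pseudonatural equivalence
`K(C, D) ≃ σ(Δ1, K(F(-), D))` of categories, pseudonatural in `D`. -/
def IsSigmaBicolimit (F : Elements W ⥤ᵖ K) (C : K) : Prop :=
  ∃ Φ : corepresentable C ⟶ sigmaBicocones F, ∀ D : K, (Φ.app D).toFunctor.IsEquivalence

end Sigma

/-! ### Bi-iso-comma objects and fully faithful morphisms in a bicategory -/

section Bicat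

variable {B : Type u₁} [Bicategory.{w₁, v₁} B]

/-- The square `l : p ≫ f ≅ q ≫ g` exhibits its corner `P` as a bi-iso-comma object of `f`, `g`. -/
structure IsBiIsoComma {X Y Z P : B} (f : X ⟶ Z) (g : Y ⟶ Z) (p : P ⟶ X) (q : P ⟶ Y)
    (l : p ≫ f ≅ q ≫ g) : Prop where
  exists_lift : ∀ {D : B} (v : D ⟶ X) (w : D ⟶ Y) (δ : v ≫ f ≅ w ≫ g),
    ∃ (t : D ⟶ P) (δ₁ : v ≅ t ≫ p) (δ₂ : t ≫ q ≅ w),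
      δ₁.hom ▷ f ≫ (α_ t p f).hom ≫ t ◁ l.hom ≫ (α_ t q g).inv ≫ δ₂.hom ▷ g = δ.hom
  existsUnique_cell : ∀ {D : B} (s t : D ⟶ P) (α : s ≫ p ≅ t ≫ p) (β : s ≫ q ≅ t ≫ q),
    α.hom ▷ f ≫ (α_ t p f).hom ≫ t ◁ l.hom ≫ (α_ t q g).inv =
      (α_ s p f).hom ≫ s ◁ l.hom ≫ (α_ s q g).inv ≫ β.hom ▷ g →
    ∃! Γ : s ⟶ t, Γ ▷ p = α.hom ∧ Γ ▷ q = β.hom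

/-- A morphism `f` of a bicategory is fully faithful if postcomposition with `f` is a fully
faithful functor on all hom-categories. -/
structure IsFullyFaithful {X Y : B} (f : X ⟶ Y) : Prop where
  full : ∀ T : B, (postcomp T f).Full
  faithful : ∀ T : B, (postcomp T f).Faithful

lemma isFullyFaithful_id (X : B) : IsFullyFaithful (𝟙 X) where
  full T := Functor.Full.of_iso (rightUnitorNatIso T X).symm
  faithful T := Functor.Faithful.of_iso (rightUnitorNatIso T X).symm

end Bicat

/-! ### Bisieves, bitopologies and stacks -/

section Bisieve

open scoped Pseudofunctor.StrongTrans

variable {K : Type u} [Bicategory.{u, u} K]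

/-- A bisieve over `C`: a fully faithful morphism `R ⟶ y(C)` in the bicategory of pseudofunctors
`Kᵒᵖ ⥤ᵖ Cat`, pseudonatural transformations and modifications. -/
structure Bisieve (C : K) where
  /-- The source `R`. -/
  source : Kᵒᵖ ⥤ᵖ Cat.{u, u}
  /-- The pseudonatural transformation `R ⟶ y(C)`. -/
  hom : source ⟶ yoneda₀ C
  isFullyFaithful : IsFullyFaithful hom

namespace Bisieve

/-- The identity of `y(C)`. -/
def id (C : K) : Bisieve C where
  source := yoneda₀ C
  hom := 𝟙 (yoneda₀ C)
  isFullyFaithful := isFullyFaithful_id _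

/-- Equivalence of bisieves over `C`. -/
def IsEquivalent {C : K} (S T : Bisieve C) : Prop :=
  ∃ e : Bicategory.Equivalence S.source T.source, Nonempty (e.hom ≫ T.hom ≅ S.hom)

/-- `T` is the top arrow `P ⟶ y(D)` of a bi-iso-comma object of `f ∘ - : y(D) ⟶ y(C)` and
`S : R ⟶ y(C)`. -/
def IsPullback {C D : K} (T : Bisieve D) (f : D ⟶ C) (S : Bisieve C) : Prop :=
  ∃ (q : T.source ⟶ S.source) (l : T.hom ≫ postcomp₂ f ≅ q ≫ S.hom),
    IsBiIsoComma (postcomp₂ f) S.hom T.hom q l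

/-- `S : R ⟶ y(C)` is a sigma-bicolim bisieve: `C` is the sigma-bicolimit of the projection
2-functor `∫ R ⥤ K`. -/
def IsSigmaBicolim {C : K} (S : Bisieve C) : Prop :=
  IsSigmaBicolimit (Elements.proj S.source).toPseudofunctor C

end Bisieve

variable (K) in
/-- A Grothendieck bitopology on `K`. -/
structure Bitopology where
  /-- The covering bisieves over `C`. -/
  covering : ∀ C : K, Set (Bisieve C)
  id_mem : ∀ C : K, Bisieve.id C ∈ covering C
  exists_pullback_mem : ∀ {C D : K} (S : Bisieve C), S ∈ covering C → ∀ f : D ⟶ C,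
    ∃ T ∈ covering D, T.IsPullback f S
  exists_equivalent_mem : ∀ {C : K} (S' : Bisieve C), S' ∈ covering C → ∀ S : Bisieve C,
    (∀ (D : K) (x : S'.source.obj (op D)),
      ∃ T ∈ covering D, T.IsPullback ((S'.hom.app (op D)).toFunctor.obj x) S) →
    ∃ T ∈ covering C, S.IsEquivalent T

namespace Bitopology

/-- `F : Kᵒᵖ ⥤ᵖ Cat` is a stack for `τ`: for every covering bisieve `S : R ⟶ y(C)`, precomposition
with `S` is an equivalence of categories `Hom(y(C), F) ⥤ Hom(R, F)`. -/
def IsStack (τ : Bitopology K) (F : Kᵒᵖ ⥤ᵖ Cat.{u, u}) : Prop :=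
  ∀ (C : K) (S : Bisieve C), S ∈ τ.covering C → (precomp F S.hom).IsEquivalence

/-- `τ` is subcanonical: all representables are stacks. -/
def IsSubcanonical (τ : Bitopology K) : Prop :=
  ∀ D : K, τ.IsStack (yoneda₀ D)

end Bitopology

end Bisieve

end Bisite

/-! The equivalence is a composite of three: `K(C, D) ≃ Hom(y(C), y(D)) ≃ Hom(R, y(D)) ≃ σ(Δ1, K(-,
D))`. The first is the bicategorical Yoneda lemma (`postcomposing₂_isEquivalence`). The second is
precomposition with `S`, an equivalence because `y(D)` is a stack and `S` covers.

The third, `transToSigma`, holds for every pseudofunctor `W` in place of `R`. A transformation `θ :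
W ⟶ y(D)` gives the cocone on `∫ W` with legs `θ(x)` and with 2-cell `θ(α)` followed by `θ(W(g)(y))
≅ g ≫ θ(y)` at `(g, α)`. Conversely, every `(g, α)` is, up to a unitor, a vertical arrow `(𝟙, α)`
followed by a cartesian arrow `(g, 𝟙)`. The vertical cells of a cocone make each `x ↦ leg(x)` a
functor, and the cartesian cells, which the sigma condition makes invertible, are the
pseudonaturality isomorphisms.

Pseudonaturality in `D` is not checked on the composite. The cocone of `S` is an object of the value
at `C` of the pseudofunctor of sigma cocones, so evaluation at it is pseudonatural
(`coyonedaTrans`). The components of this transformation are isomorphic to the composite above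
(`evalTransToSigmaIso`), hence are equivalences. -/

namespace Bisite

/-! ### Pseudonatural transformations into a representable, elementwise -/

namespace YonedaTrans

open scoped Pseudofunctor.StrongTrans

variable {B : Type u₁} [Bicategory.{w₁, v₁} B] {R : Bᵒᵖ ⥤ᵖ Cat.{w₁, v₁}} {D : B}

/-- The value `θ(x) : X ⟶ D` of `θ : R ⟶ y(D)` at `x ∈ R(X)`. -/
def obj (θ : R ⟶ yoneda₀ D) {X : B} (x : R.obj (op X)) : X ⟶ D :=
  (θ.app (op X)).toFunctor.obj x

/-- The value of `θ : R ⟶ y(D)` at a morphism of `R(X)`. -/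
def map (θ : R ⟶ yoneda₀ D) {X : B} {x y : R.obj (op X)} (a : x ⟶ y) : obj θ x ⟶ obj θ y :=
  (θ.app (op X)).toFunctor.map a

/-- The structure isomorphism `θ(R(g)(x)) ≅ g ≫ θ(x)` of `θ : R ⟶ y(D)`. -/
def nat (θ : R ⟶ yoneda₀ D) {X Y : B} (g : X ⟶ Y) (x : R.obj (op Y)) :
    obj θ ((R.map g.op).toFunctor.obj x) ≅ g ≫ obj θ x :=
  (Cat.Hom.toNatIso (θ.naturality g.op)).app x

section

variable (θ : R ⟶ yoneda₀ D)

@[simp]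
lemma map_id {X : B} (x : R.obj (op X)) : map θ (𝟙 x) = 𝟙 (obj θ x) :=
  (θ.app (op X)).toFunctor.map_id x

@[simp]
lemma map_comp {X : B} {x y z : R.obj (op X)} (a : x ⟶ y) (b : y ⟶ z) :
    map θ (a ≫ b) = map θ a ≫ map θ b :=
  (θ.app (op X)).toFunctor.map_comp a b

lemma map_nat {X Y : B} (g : X ⟶ Y) {x y : R.obj (op Y)} (a : x ⟶ y) :
    map θ ((R.map g.op).toFunctor.map a) ≫ (nat θ g y).hom = (nat θ g x).hom ≫ g ◁ map θ a :=
  (θ.naturality g.op).hom.toNatTrans.naturality a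

lemma map_map₂_nat {X Y : B} {g h : X ⟶ Y} (d : g ⟶ h) (x : R.obj (op Y)) :
    map θ ((R.map₂ (op2 d)).toNatTrans.app x) ≫ (nat θ h x).hom =
      (nat θ g x).hom ≫ d ▷ obj θ x :=
  congrArg (fun k => k.toNatTrans.app x) (θ.naturality_naturality (op2 d))

lemma nat_id {X : B} (x : R.obj (op X)) :
    (nat θ (𝟙 X) x).hom ≫ (λ_ (obj θ x)).hom =
      map θ ((R.mapId (op X)).hom.toNatTrans.app x) := by
  have h := congrArg (fun k => k.toNatTrans.app x) (θ.naturality_id (op X))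
  refine Eq.trans h ?_
  change map θ _ ≫ 𝟙 _ ≫ 𝟙 _ = _
  simp

lemma nat_comp {X Y Z : B} (f : X ⟶ Y) (g : Y ⟶ Z) (z : R.obj (op Z)) :
    (nat θ (f ≫ g) z).hom ≫ (α_ f g (obj θ z)).hom =
      map θ ((R.mapComp g.op f.op).hom.toNatTrans.app z) ≫
        (nat θ f ((R.map g.op).toFunctor.obj z)).hom ≫ f ◁ (nat θ g z).hom := by
  have h := congrArg (fun k => k.toNatTrans.app z) (θ.naturality_comp g.op f.op)
  refine Eq.trans h ?_
  change map θ _ ≫ 𝟙 _ ≫ (nat θ f _).hom ≫ 𝟙 _ ≫ (f ◁ (nat θ g z).hom) ≫ 𝟙 _ = _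
  simp only [Category.id_comp, Category.comp_id]

end

/-- Build a pseudonatural transformation `R ⟶ y(D)` from elementwise data. -/
def mk (F : ∀ X : B, R.obj (op X) ⥤ (X ⟶ D))
    (n : ∀ {X Y : B} (g : X ⟶ Y) (x : R.obj (op Y)),
      (F X).obj ((R.map g.op).toFunctor.obj x) ≅ g ≫ (F Y).obj x)
    (h₁ : ∀ {X Y : B} (g : X ⟶ Y) {x y : R.obj (op Y)} (a : x ⟶ y),
      (F X).map ((R.map g.op).toFunctor.map a) ≫ (n g y).hom = (n g x).hom ≫ g ◁ (F Y).map a)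
    (h₂ : ∀ {X Y : B} {g h : X ⟶ Y} (d : g ⟶ h) (x : R.obj (op Y)),
      (F X).map ((R.map₂ (op2 d)).toNatTrans.app x) ≫ (n h x).hom =
        (n g x).hom ≫ d ▷ (F Y).obj x)
    (h₃ : ∀ {X : B} (x : R.obj (op X)), (n (𝟙 X) x).hom ≫ (λ_ ((F X).obj x)).hom =
      (F X).map ((R.mapId (op X)).hom.toNatTrans.app x))
    (h₄ : ∀ {X Y Z : B} (f : X ⟶ Y) (g : Y ⟶ Z) (z : R.obj (op Z)),
      (n (f ≫ g) z).hom ≫ (α_ f g ((F Z).obj z)).hom =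
        (F X).map ((R.mapComp g.op f.op).hom.toNatTrans.app z) ≫
          (n f ((R.map g.op).toFunctor.obj z)).hom ≫ f ◁ (n g z).hom) :
    R ⟶ yoneda₀ D :=
  { app X := (F X.unop).toCatHom
    naturality {Y X} g := Cat.Hom.isoMk (F := (R.map g).toFunctor ⋙ F X.unop)
      (G := F Y.unop ⋙ precomp D g.unop)
      (NatIso.ofComponents (fun x => n g.unop x) (fun a => h₁ g.unop a))
    naturality_naturality {Y X g h} d := by
      ext x
      exact h₂ d.unop2 x
    naturality_id X := by
      ext x
      refine Eq.trans (h₃ (X := X.unop) x) ?_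
      change _ = (F X.unop).map _ ≫ 𝟙 _ ≫ 𝟙 _
      erw [Category.comp_id, Category.comp_id]
    naturality_comp {Z Y X} g f := by
      ext z
      refine Eq.trans (h₄ f.unop g.unop z) ?_
      change _ = (F X.unop).map _ ≫ 𝟙 _ ≫ (n f.unop _).hom ≫ 𝟙 _ ≫ (f.unop ◁ (n g.unop z).hom) ≫ 𝟙 _
      erw [Category.comp_id, Category.id_comp, Category.id_comp]
      rfl }

/-- The component of a modification at an object of `R(X)`. -/
def app {θ κ : R ⟶ yoneda₀ D} (m : θ ⟶ κ) {X : B} (x : R.obj (op X)) : obj θ x ⟶ obj κ x :=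
  (m.as.app (op X)).toNatTrans.app x

section

variable {θ κ : R ⟶ yoneda₀ D} (m : θ ⟶ κ)

lemma app_naturality {X : B} {x y : R.obj (op X)} (a : x ⟶ y) :
    map θ a ≫ app m y = app m x ≫ map κ a :=
  (m.as.app (op X)).toNatTrans.naturality a

lemma app_nat {X Y : B} (g : X ⟶ Y) (x : R.obj (op Y)) :
    app m ((R.map g.op).toFunctor.obj x) ≫ (nat κ g x).hom = (nat θ g x).hom ≫ g ◁ app m x :=
  congrArg (fun k => k.toNatTrans.app x) (m.as.naturality g.op)

end

lemma hom_ext {θ κ : R ⟶ yoneda₀ D} {m m' : θ ⟶ κ}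
    (h : ∀ {X : B} (x : R.obj (op X)), app m x = app m' x) : m = m' := by
  ext X : 1
  ext x
  exact h (X := X.unop) x

/-- Build a modification between transformations `R ⟶ y(D)` from elementwise data. -/
def homMk {θ κ : R ⟶ yoneda₀ D} (p : ∀ {X : B} (x : R.obj (op X)), obj θ x ⟶ obj κ x)
    (h₁ : ∀ {X : B} {x y : R.obj (op X)} (a : x ⟶ y), map θ a ≫ p y = p x ≫ map κ a)
    (h₂ : ∀ {X Y : B} (g : X ⟶ Y) (x : R.obj (op Y)),
      p ((R.map g.op).toFunctor.obj x) ≫ (nat κ g x).hom = (nat θ g x).hom ≫ g ◁ p x) :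
    θ ⟶ κ where
  as :=
    { app X := NatTrans.toCatHom₂ (F := (θ.app X).toFunctor) (G := (κ.app X).toFunctor)
        { app x := p (X := X.unop) x
          naturality _ _ a := h₁ (X := X.unop) a }
      naturality {Y X} g := by
        ext x
        exact h₂ g.unop x }

/-- Build an invertible modification between transformations `R ⟶ y(D)` from elementwise data. -/
def isoMk {θ κ : R ⟶ yoneda₀ D} (p : ∀ {X : B} (x : R.obj (op X)), obj θ x ≅ obj κ x)
    (h₁ : ∀ {X : B} {x y : R.obj (op X)} (a : x ⟶ y), map θ a ≫ (p y).hom = (p x).hom ≫ map κ a)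
    (h₂ : ∀ {X Y : B} (g : X ⟶ Y) (x : R.obj (op Y)),
      (p ((R.map g.op).toFunctor.obj x)).hom ≫ (nat κ g x).hom =
        (nat θ g x).hom ≫ g ◁ (p x).hom) : θ ≅ κ where
  hom := homMk (fun x => (p x).hom) h₁ h₂
  inv := homMk (fun x => (p x).inv)
    (fun a => by rw [← cancel_epi (p _).hom, ← reassoc_of% (h₁ a)]; simp)
    (fun g x => by
      rw [← cancel_epi (p _).hom, reassoc_of% (h₂ g x)]
      simp [← Bicategory.whiskerLeft_comp])
  hom_inv_id := hom_ext fun x => (p x).hom_inv_id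
  inv_hom_id := hom_ext fun x => (p x).inv_hom_id

end YonedaTrans

/-! ### The Yoneda embedding is locally an equivalence -/

section Yoneda

open scoped Pseudofunctor.StrongTrans

variable {B : Type u₁} [Bicategory.{w₁, v₁} B] (C D : B)

open YonedaTrans

/-- A 2-cell `η` is recovered from `𝟙 C ◁ η`, the component at the universal element `𝟙 C`. -/
instance postcomposing₂_faithful : (postcomposing₂ C D).Faithful where
  map_injective {r s} η θ h := by
    have := congrArg (fun m => app m (𝟙 C : (yoneda₀ C).obj (op C))) h
    change 𝟙 C ◁ η = 𝟙 C ◁ θ at this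
    simpa using this

instance postcomposing₂_full : (postcomposing₂ C D).Full where
  map_surjective {r s} m := by
    refine ⟨(λ_ r).inv ≫ app m (𝟙 C : (yoneda₀ C).obj (op C)) ≫ (λ_ s).hom, hom_ext ?_⟩
    intro X (x : X ⟶ C)
    -- Here `q`, `p` and `e` are the components of `m` at `x`, `x ≫ 𝟙 C` and `𝟙 C`. Naturality along
    -- `ρ_ x` ties `q` to `p`, and compatibility with restriction along `x` ties `p` to `e`.
    have key (p : (x ≫ 𝟙 C) ≫ r ⟶ (x ≫ 𝟙 C) ≫ s) (q : x ≫ r ⟶ x ≫ s)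
        (e : 𝟙 C ≫ r ⟶ 𝟙 C ≫ s) (h₁ : (ρ_ x).hom ▷ r ≫ q = p ≫ (ρ_ x).hom ▷ s)
        (h₂ : p ≫ (α_ x (𝟙 C) s).hom = (α_ x (𝟙 C) r).hom ≫ x ◁ e) :
        x ◁ ((λ_ r).inv ≫ e ≫ (λ_ s).hom) = q := by
      rw [← cancel_epi ((ρ_ x).hom ▷ r), h₁, ← triangle x s, ← triangle_assoc x r,
        reassoc_of% h₂]
      simp
    exact key _ _ _ (app_naturality m (X := X) (x := x ≫ 𝟙 C) (y := x) (ρ_ x).hom)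
      (app_nat m x (𝟙 C : (yoneda₀ C).obj (op C)))

instance postcomposing₂_essSurj : (postcomposing₂ C D).EssSurj where
  mem_essImage θ := by
    let i : (yoneda₀ C).obj (op C) := 𝟙 C
    -- The comparison at `x` is `x ≫ θ(𝟙) ≅ θ(x ≫ 𝟙) ≅ θ(x)`; the second step applies `θ` to the
    -- right unitor.
    refine ⟨obj θ i, ⟨isoMk (κ := θ) (θ := postcomp₂ (obj θ i))
      (fun {X} x => (nat θ x i).symm ≪≫
        ((θ.app (op X)).toFunctor.mapIso (ρ_ (show X ⟶ C from x)) :)) ?_ ?_⟩⟩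
    · intro X (x : X ⟶ C) (y : X ⟶ C) (a : x ⟶ y)
      change a ▷ obj θ i ≫ (nat θ y i).inv ≫ map θ (X := X) (x := y ≫ 𝟙 C) (y := y) (ρ_ y).hom =
        ((nat θ x i).inv ≫ map θ (X := X) (x := x ≫ 𝟙 C) (y := x) (ρ_ x).hom) ≫ map θ a
      have h₁ : map θ (X := X) (x := x ≫ 𝟙 C) (y := y ≫ 𝟙 C) (a ▷ 𝟙 C) ≫ (nat θ y i).hom =
        (nat θ x i).hom ≫ a ▷ obj θ i := map_map₂_nat θ a i
      have h₂ := congrArg (map θ (X := X) (x := x ≫ 𝟙 C) (y := y)) (rightUnitor_naturality a)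
      have key {x₀ x₁ x₂ y₀ y₁ y₂ : X ⟶ D} (nx : x₁ ≅ x₂) (ny : y₁ ≅ y₂) (a₀ : x₀ ⟶ y₀)
          (a₁ : x₁ ⟶ y₁) (a₂ : x₂ ⟶ y₂) (rx : x₁ ⟶ x₀) (ry : y₁ ⟶ y₀)
          (h₁ : a₁ ≫ ny.hom = nx.hom ≫ a₂) (h₂ : a₁ ≫ ry = rx ≫ a₀) :
          a₂ ≫ ny.inv ≫ ry = (nx.inv ≫ rx) ≫ a₀ := by
        rw [Category.assoc, ← h₂, ← cancel_epi nx.hom, ← reassoc_of% h₁]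
        simp
      exact key _ _ _ _ _ _ _ h₁ ((map_comp θ _ _).symm.trans (h₂.trans (map_comp θ _ _)))
    · intro X Y g (x : Y ⟶ C)
      change ((nat θ (g ≫ x) i).inv ≫ map θ (X := X) (x := (g ≫ x) ≫ 𝟙 C) (y := g ≫ x)
          (ρ_ (g ≫ x)).hom) ≫ (nat θ g x).hom =
        (α_ g x (obj θ i)).hom ≫ g ◁ ((nat θ x i).inv ≫
          map θ (X := Y) (x := x ≫ 𝟙 C) (y := x) (ρ_ x).hom)
      -- Three ingredients: coherence of `θ` for the composite `g ≫ x`, naturality of `nat θ g`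
      -- along `ρ_ x`, and the factorization of `ρ_ (g ≫ x)` through the associator and `g ◁ ρ_ x`.
      have h₁ : (nat θ (g ≫ x) i).hom ≫ (α_ g x (obj θ i)).hom =
          map θ (X := X) (x := (g ≫ x) ≫ 𝟙 C) (y := g ≫ x ≫ 𝟙 C) (α_ g x (𝟙 C)).hom ≫
            (nat θ g (x ≫ 𝟙 C : Y ⟶ C)).hom ≫ g ◁ (nat θ x i).hom := nat_comp θ g x i
      have h₂ : map θ (X := X) (x := g ≫ x ≫ 𝟙 C) (y := g ≫ x) (g ◁ (ρ_ x).hom) ≫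
          (nat θ g x).hom = (nat θ g (x ≫ 𝟙 C : Y ⟶ C)).hom ≫
            g ◁ map θ (X := Y) (x := x ≫ 𝟙 C) (y := x) (ρ_ x).hom :=
        map_nat θ g (x := x ≫ 𝟙 C) (y := x) (ρ_ x).hom
      have h₃ := congrArg (map θ (X := X) (x := (g ≫ x) ≫ 𝟙 C) (y := g ≫ x))
        (rightUnitor_comp g x)
      have key {p q q' : X ⟶ D} {w t z : Y ⟶ D} {v : X ⟶ D} (n : p ≅ v) (b : v ⟶ g ≫ t)
          (nx : w ≅ t) (k : q ⟶ g ≫ w) (k' : q' ⟶ g ≫ z) (m : p ⟶ q) (r : w ⟶ z) (r' : q ⟶ q')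
          (c : p ⟶ q') (h₁ : n.hom ≫ b = m ≫ k ≫ g ◁ nx.hom) (h₂ : r' ≫ k' = k ≫ g ◁ r)
          (h₃ : c = m ≫ r') : (n.inv ≫ c) ≫ k' = b ≫ g ◁ (nx.inv ≫ r) := by
        rw [← cancel_epi n.hom, reassoc_of% h₁, h₃]
        simp [h₂]
      exact key _ _ _ _ _ _ _ _ _ h₁ h₂ (h₃.trans (map_comp θ _ _))

instance postcomposing₂_isEquivalence : (postcomposing₂ C D).IsEquivalence where

end Yoneda

end Bisite

namespace Bisite

/-! ### The covariant Yoneda lemma: from objects to pseudonatural transformations -/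

section Coyoneda

open scoped Pseudofunctor.StrongTrans

variable {B : Type u₁} [Bicategory.{w₁, v₁} B] (P : B ⥤ᵖ Cat.{w₁, v₁}) {C : B} (c : P.obj C)

/-- The functor `B(C, D) ⥤ P(D)`, `t ↦ P(t)(c)`. -/
@[simps]
def evalFunctor (D : B) : (C ⟶ D) ⥤ P.obj D where
  obj t := (P.map t).toFunctor.obj c
  map η := (P.map₂ η).toNatTrans.app c
  map_id t := by simp
  map_comp η θ := by simp

/-- The pseudonatural transformation `B(C, -) ⟶ P` that corresponds to `c ∈ P(C)`. -/
def coyonedaTrans : corepresentable C ⟶ P :=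
  { app D := (evalFunctor P c D).toCatHom
    naturality {D E} r := Cat.Hom.isoMk (F := postcomp C r ⋙ evalFunctor P c E)
      (G := evalFunctor P c D ⋙ (P.map r).toFunctor)
      (NatIso.ofComponents (fun t => (Cat.Hom.toNatIso (P.mapComp t r)).app c) (fun {t t'} η => by
        change (P.map₂ (η ▷ r)).toNatTrans.app c ≫ (P.mapComp t' r).hom.toNatTrans.app c =
          (P.mapComp t r).hom.toNatTrans.app c ≫
            (P.map r).toFunctor.map ((P.map₂ η).toNatTrans.app c)
        simp))
    naturality_naturality {D E r s} η := by
      ext t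
      revert t
      change ∀ t : C ⟶ D, (P.map₂ (t ◁ η)).toNatTrans.app c ≫
        (P.mapComp t s).hom.toNatTrans.app c = (P.mapComp t r).hom.toNatTrans.app c ≫
          (P.map₂ η).toNatTrans.app ((P.map t).toFunctor.obj c)
      intro t
      simp
    naturality_id D := by
      ext t
      revert t
      change ∀ t : C ⟶ D, (P.mapComp t (𝟙 D)).hom.toNatTrans.app c ≫
        (P.mapId D).hom.toNatTrans.app ((P.map t).toFunctor.obj c) =
          (P.map₂ (ρ_ t).hom).toNatTrans.app c ≫ 𝟙 _ ≫ 𝟙 _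
      intro t
      simp
    naturality_comp {D E G} r s := by
      ext t
      revert t
      change ∀ t : C ⟶ D, (P.mapComp t (r ≫ s)).hom.toNatTrans.app c ≫
        (P.mapComp r s).hom.toNatTrans.app ((P.map t).toFunctor.obj c) =
          (P.map₂ (α_ t r s).inv).toNatTrans.app c ≫ 𝟙 _ ≫
            (P.mapComp (t ≫ r) s).hom.toNatTrans.app c ≫ 𝟙 _ ≫
              (P.map s).toFunctor.map ((P.mapComp t r).hom.toNatTrans.app c) ≫ 𝟙 _
      intro t
      -- Compatibility with composition is the associativity coherence of `P`, evaluated at `c`.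
      simp [Pseudofunctor.mapComp_assoc_right_hom_app] }

end Coyoneda

/-! ### Sigma natural transformations into `K(-, D)`, elementwise -/

namespace Bicone

open scoped Oplax.OplaxTrans

variable {A : Type u} [Bicategory.{u, u} A] {W : Aᵒᵖ ⥤ᵖ Cat.{u, u}} {D : A}

variable (W D) in
/-- The oplax cocones with vertex `D` under the projection `∫ W ⥤ A`. -/
abbrev Cocone := (delta W).toOplax ⟶ (homInto (Elements.proj W).toPseudofunctor D).toOplax

/-- The leg of an oplax cocone at `X`. -/
def leg (γ : Cocone W D) (X : Elements W) : X.base ⟶ D :=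
  (γ.app (op X)).toFunctor.obj ⟨⟨⟩⟩

/-- The image of the identity of the point under the leg of an oplax cocone at `X`. -/
def legMap (γ : Cocone W D) (X : Elements W) : leg γ X ⟶ leg γ X :=
  (γ.app (op X)).toFunctor.map (𝟙 (⟨⟨⟩⟩ : Discrete PUnit.{u + 1}))

@[simp]
lemma legMap_eq (γ : Cocone W D) (X : Elements W) : legMap γ X = 𝟙 (leg γ X) :=
  (γ.app (op X)).toFunctor.map_id _

/-- The structure 2-cell of an oplax cocone at `f : X ⟶ Y`. -/
def cell (γ : Cocone W D) {X Y : Elements W} (f : X ⟶ Y) : leg γ X ⟶ f.base ≫ leg γ Y :=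
  (γ.naturality f.op).toNatTrans.app ⟨⟨⟩⟩

section

variable (γ : Cocone W D)

/-- `Δ1` contributes only identities and the projection is strict, so the three oplax axioms keep no
coherence cells beyond the unitors and associators of `A`. This lemma and the next two are what
remains of them. -/
lemma cell_hom₂ {X Y : Elements W} {f g : X ⟶ Y} (η : f ⟶ g) :
    cell γ f ≫ η.cell ▷ leg γ Y = cell γ g := by
  have h := congrArg (fun k => k.toNatTrans.app ⟨⟨⟩⟩) (γ.naturality_naturality (op2 η))
  refine h.symm.trans ?_
  change legMap γ X ≫ cell γ g = _
  simp

lemma cell_id (X : Elements W) : cell γ (𝟙 X) ≫ (λ_ (leg γ X)).hom = 𝟙 (leg γ X) := by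
  have h := congrArg (fun k => k.toNatTrans.app ⟨⟨⟩⟩) (γ.naturality_id (op X))
  change cell γ (𝟙 X) ≫ (𝟙 (𝟙 X.base) ▷ leg γ X ≫ (λ_ (leg γ X)).hom) =
    legMap γ X ≫ 𝟙 (leg γ X) ≫ 𝟙 (leg γ X) at h
  simpa using h

lemma cell_comp {X Y Z : Elements W} (f : X ⟶ Y) (g : Y ⟶ Z) :
    cell γ (f ≫ g) ≫ (α_ f.base g.base (leg γ Z)).hom =
      cell γ f ≫ f.base ◁ cell γ g := by
  have h := congrArg (fun k => k.toNatTrans.app ⟨⟨⟩⟩) (γ.naturality_comp g.op f.op)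
  change cell γ (f ≫ g) ≫ (𝟙 (f.base ≫ g.base) ▷ leg γ Z ≫ (α_ f.base g.base (leg γ Z)).hom) =
    legMap γ X ≫ 𝟙 (leg γ X) ≫ cell γ f ≫ 𝟙 (f.base ≫ leg γ Y) ≫ f.base ◁ cell γ g ≫
      𝟙 (f.base ≫ g.base ≫ leg γ Z) at h
  simpa using h

end

/-- Build an oplax cocone from its legs and its structure 2-cells. -/
def mk (l : ∀ X : Elements W, X.base ⟶ D)
    (s : ∀ {X Y : Elements W} (f : X ⟶ Y), l X ⟶ f.base ≫ l Y)
    (h₂ : ∀ {X Y : Elements W} {f g : X ⟶ Y} (η : f ⟶ g), s f ≫ η.cell ▷ l Y = s g)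
    (h₃ : ∀ X : Elements W, s (𝟙 X) ≫ (λ_ (l X)).hom = 𝟙 (l X))
    (h₄ : ∀ {X Y Z : Elements W} (f : X ⟶ Y) (g : Y ⟶ Z),
      s (f ≫ g) ≫ (α_ f.base g.base (l Z)).hom = s f ≫ f.base ◁ s g) :
    Cocone W D where
  app X := ((Functor.const (Discrete PUnit.{u + 1})).obj (l X.unop)).toCatHom
  naturality {Y X} f := NatTrans.toCatHom₂
    (F := 𝟭 _ ⋙ (Functor.const (Discrete PUnit.{u + 1})).obj (l X.unop))
    (G := (Functor.const (Discrete PUnit.{u + 1})).obj (l Y.unop) ⋙ precomp D f.unop.base)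
    { app _ := s f.unop
      naturality _ _ _ := by
        change 𝟙 _ ≫ _ = _ ≫ f.unop.base ◁ 𝟙 _
        simp }
  naturality_naturality {Y X f g} η := by
    ext ⟨⟨⟩⟩
    change 𝟙 _ ≫ s g.unop = s f.unop ≫ η.unop2.cell ▷ l Y.unop
    simp [h₂]
  naturality_id X := by
    ext ⟨⟨⟩⟩
    change s (𝟙 X.unop) ≫ (𝟙 (𝟙 X.unop.base) ▷ l X.unop ≫ (λ_ (l X.unop)).hom) = 𝟙 _ ≫ 𝟙 _ ≫ 𝟙 _
    simp [h₃]
  naturality_comp {Z Y X} g f := by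
    ext ⟨⟨⟩⟩
    change s (f.unop ≫ g.unop) ≫ (𝟙 (f.unop.base ≫ g.unop.base) ▷ l Z.unop ≫
        (α_ f.unop.base g.unop.base (l Z.unop)).hom) =
      𝟙 _ ≫ 𝟙 _ ≫ s f.unop ≫ 𝟙 _ ≫ f.unop.base ◁ s g.unop ≫ 𝟙 _
    simp [h₄]

/-- The component of a modification between oplax cocones. -/
def app {γ δ : Cocone W D} (m : γ ⟶ δ) (X : Elements W) : leg γ X ⟶ leg δ X :=
  (m.as.app (op X)).toNatTrans.app ⟨⟨⟩⟩

lemma app_cell {γ δ : Cocone W D} (m : γ ⟶ δ) {X Y : Elements W} (f : X ⟶ Y) :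
    app m X ≫ cell δ f = cell γ f ≫ f.base ◁ app m Y :=
  congrArg (fun k => k.toNatTrans.app ⟨⟨⟩⟩) (m.as.naturality f.op)

lemma hom_ext {γ δ : Cocone W D} {m m' : γ ⟶ δ} (h : ∀ X, app m X = app m' X) : m = m' := by
  ext X : 1
  ext ⟨⟨⟩⟩
  exact h X.unop

/-- Build a modification between oplax cocones from its components. -/
def homMk {γ δ : Cocone W D} (p : ∀ X, leg γ X ⟶ leg δ X)
    (h : ∀ {X Y : Elements W} (f : X ⟶ Y), p X ≫ cell δ f = cell γ f ≫ f.base ◁ p Y) :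
    γ ⟶ δ where
  as :=
    { app X := NatTrans.toCatHom₂ (F := (γ.app X).toFunctor) (G := (δ.app X).toFunctor)
        { app | ⟨⟨⟩⟩ => p X.unop
          naturality := by
            rintro ⟨⟨⟩⟩ ⟨⟨⟩⟩ ⟨⟨⟨⟩⟩⟩
            change legMap γ X.unop ≫ p X.unop = p X.unop ≫ legMap δ X.unop
            simp }
      naturality {Y X} f := by
        ext ⟨⟨⟩⟩
        exact h f.unop }

/-- Build an invertible modification between oplax cocones from its components. -/
def isoMk {γ δ : Cocone W D} (p : ∀ X, leg γ X ≅ leg δ X)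
    (h : ∀ {X Y : Elements W} (f : X ⟶ Y),
      (p X).hom ≫ cell δ f = cell γ f ≫ f.base ◁ (p Y).hom) : γ ≅ δ where
  hom := homMk (fun X => (p X).hom) h
  inv := homMk (fun X => (p X).inv) (fun f => by
    rw [← cancel_epi (p _).hom, reassoc_of% (h f)]
    simp [← Bicategory.whiskerLeft_comp])
  hom_inv_id := hom_ext fun X => (p X).hom_inv_id
  inv_hom_id := hom_ext fun X => (p X).inv_hom_id

end Bicone

end Bisite

namespace Bisite

/-! ### Vertical arrows and modifications, in the form needed on `∫ W` -/

namespace YonedaTrans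

open scoped Pseudofunctor.StrongTrans

variable {B : Type u₁} [Bicategory.{w₁, v₁} B] {R : Bᵒᵖ ⥤ᵖ Cat.{w₁, v₁}} {D : B}

/-- The left side is the cell of the cocone of `θ` at the vertical arrow over `𝟙 X` given by `a`; it
carries the same information as `θ(a)`. -/
lemma map_nat_id (θ : R ⟶ yoneda₀ D) {X : B} {x y : R.obj (op X)} (a : x ⟶ y) :
    map θ (a ≫ (R.mapId (op X)).inv.toNatTrans.app y) ≫ (nat θ (𝟙 X) y).hom =
      map θ a ≫ (λ_ (obj θ y)).inv := by
  rw [Iso.eq_comp_inv, Category.assoc]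
  erw [nat_id]
  refine (map_comp θ _ _).symm.trans (congrArg (map θ) ?_)
  rw [Category.assoc]
  erw [Cat.Hom.inv_hom_id_toNatTrans_app, Category.comp_id]

lemma app_map_nat {θ κ : R ⟶ yoneda₀ D} (m : θ ⟶ κ) {X Y : B} (g : X ⟶ Y) {x : R.obj (op X)}
    {y : R.obj (op Y)} (a : x ⟶ (R.map g.op).toFunctor.obj y) :
    app m x ≫ map κ a ≫ (nat κ g y).hom = (map θ a ≫ (nat θ g y).hom) ≫ g ◁ app m y := by
  rw [← reassoc_of% (app_naturality m), app_nat, Category.assoc]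

end YonedaTrans

namespace Bicone

open scoped Oplax.OplaxTrans Pseudofunctor.StrongTrans

variable {A : Type u} [Bicategory.{u, u} A] {W : Aᵒᵖ ⥤ᵖ Cat.{u, u}} {D : A}

/-! ### From pseudonatural transformations to sigma natural transformations -/

/-- The oplax cocone that corresponds to a pseudonatural transformation `W ⟶ y(D)`. -/
def ofTrans (θ : W ⟶ yoneda₀ D) : Cocone W D :=
  mk (fun X => YonedaTrans.obj θ X.fiber)
    (fun {_ Y} f => YonedaTrans.map θ f.fiber ≫ (YonedaTrans.nat θ f.base Y.fiber).hom)
    (fun {X Y f g} η => by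
      rw [Category.assoc, ← YonedaTrans.map_map₂_nat, ← reassoc_of% (YonedaTrans.map_comp θ), η.w])
    (fun X => by
      rw [Category.assoc]
      erw [YonedaTrans.nat_id]
      refine (YonedaTrans.map_comp θ _ _).symm.trans ?_
      erw [Cat.Hom.inv_hom_id_toNatTrans_app]
      exact YonedaTrans.map_id θ _)
    (fun {X Y Z} f g => by
      rw [Category.assoc]
      -- This produces a `mapComp` that cancels the inverse `mapComp` in the fiber of a composite of
      -- `∫ W`.
      erw [YonedaTrans.nat_comp]
      rw [Bicategory.whiskerLeft_comp, Category.assoc, ← reassoc_of% (YonedaTrans.map_nat θ),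
        ← reassoc_of% (YonedaTrans.map_comp θ), ← reassoc_of% (YonedaTrans.map_comp θ)]
      congr 2
      simp only [Elements.categoryStruct_comp_fiber, Category.assoc]
      erw [Cat.Hom.inv_hom_id_toNatTrans_app]
      erw [Category.comp_id])

/-- The functor from pseudonatural transformations `W ⟶ y(D)` to oplax cocones. -/
def ofTransFunctor (W : Aᵒᵖ ⥤ᵖ Cat.{u, u}) (D : A) : (W ⟶ yoneda₀ D) ⥤ Cocone W D where
  obj θ := ofTrans θ
  map m := homMk (fun X => YonedaTrans.app m X.fiber) (fun f =>
    YonedaTrans.app_map_nat m f.base f.fiber)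
  map_id _ := rfl
  map_comp _ _ := rfl

instance : (ofTransFunctor W D).Faithful where
  map_injective h := YonedaTrans.hom_ext fun {X} x =>
    congrArg (fun k => app k (⟨X, x⟩ : Elements W)) h

/-- The single cocone axiom for a modification contains both axioms wanted: at vertical arrows it
gives naturality in `W(X)`, and at cartesian arrows `(g, 𝟙)` compatibility with restriction along
`g`. -/
instance : (ofTransFunctor W D).Full where
  map_surjective {θ κ} m := by
    refine ⟨YonedaTrans.homMk (fun {X} x => app m (⟨X, x⟩ : Elements W)) ?_ ?_, rfl⟩
    · intro X x y a
      have key {p q r s : X ⟶ D} (a : p ⟶ r) (b : q ⟶ s) (e : p ⟶ q) (e' : r ⟶ s)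
          (h : e ≫ b ≫ (λ_ s).inv = (a ≫ (λ_ r).inv) ≫ 𝟙 X ◁ e') : a ≫ e' = e ≫ b := by
        rw [← cancel_mono (λ_ s).inv, Category.assoc, Category.assoc, h]
        simp
      refine key (YonedaTrans.map θ a) (YonedaTrans.map κ a) _ _ ?_
      rw [← YonedaTrans.map_nat_id, ← YonedaTrans.map_nat_id]
      exact app_cell m (⟨𝟙 X, a ≫ (W.mapId (op X)).inv.toNatTrans.app y⟩ :
        (⟨X, x⟩ : Elements W) ⟶ ⟨X, y⟩)
    · intro X Y g x
      have key {p p' : X ⟶ D} {q q' : Y ⟶ D} (a : p ⟶ g ≫ q) (b : p' ⟶ g ≫ q') (e : p ⟶ p)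
          (e' : p' ⟶ p') (he : e = 𝟙 p) (he' : e' = 𝟙 p') (c : p ⟶ p') (d : q ⟶ q')
          (h : c ≫ e' ≫ b = (e ≫ a) ≫ g ◁ d) : c ≫ b = a ≫ g ◁ d := by
        subst he he'
        simpa using h
      exact key _ _ _ _ (YonedaTrans.map_id θ _) (YonedaTrans.map_id κ _) _ _
        (app_cell m (⟨g, 𝟙 _⟩ : (⟨X, (W.map g.op).toFunctor.obj x⟩ : Elements W) ⟶ ⟨Y, x⟩))

/-! ### From sigma natural transformations to pseudonatural transformations -/

section

variable (γ : Cocone W D)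

/-- The leg of an oplax cocone at `(X, x)`. -/
def legAt {X : A} (x : W.obj (op X)) : X ⟶ D := leg γ ⟨X, x⟩

/-- The structure 2-cell of an oplax cocone at `(g, a)`. -/
def cellAt {X Y : A} (g : X ⟶ Y) {x : W.obj (op X)} {y : W.obj (op Y)}
    (a : x ⟶ (W.map g.op).toFunctor.obj y) : legAt γ x ⟶ g ≫ legAt γ y :=
  cell γ (⟨g, a⟩ : (⟨X, x⟩ : Elements W) ⟶ ⟨Y, y⟩)

lemma cellAt_map₂ {X Y : A} {g h : X ⟶ Y} (d : g ⟶ h) {x : W.obj (op X)} {y : W.obj (op Y)}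
    (a : x ⟶ (W.map g.op).toFunctor.obj y) :
    cellAt γ g a ≫ d ▷ legAt γ y = cellAt γ h (a ≫ (W.map₂ (op2 d)).toNatTrans.app y) :=
  cell_hom₂ γ (f := (⟨g, a⟩ : (⟨X, x⟩ : Elements W) ⟶ ⟨Y, y⟩))
    (g := ⟨h, a ≫ (W.map₂ (op2 d)).toNatTrans.app y⟩) ⟨d, rfl⟩

lemma cellAt_id {X : A} (x : W.obj (op X)) :
    cellAt γ (𝟙 X) ((W.mapId (op X)).inv.toNatTrans.app x) ≫ (λ_ (legAt γ x)).hom =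
      𝟙 (legAt γ x) :=
  cell_id γ ⟨X, x⟩

lemma cellAt_comp {X Y Z : A} (f : X ⟶ Y) (g : Y ⟶ Z) {x : W.obj (op X)} {y : W.obj (op Y)}
    {z : W.obj (op Z)} (a : x ⟶ (W.map f.op).toFunctor.obj y)
    (b : y ⟶ (W.map g.op).toFunctor.obj z) :
    cellAt γ (f ≫ g) (a ≫ (W.map f.op).toFunctor.map b ≫
      (W.mapComp g.op f.op).inv.toNatTrans.app z) ≫ (α_ f g (legAt γ z)).hom =
        cellAt γ f a ≫ f ◁ cellAt γ g b :=
  cell_comp γ (⟨f, a⟩ : (⟨X, x⟩ : Elements W) ⟶ ⟨Y, y⟩) 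
    (⟨g, b⟩ : (⟨Y, y⟩ : Elements W) ⟶ ⟨Z, z⟩)

/-- The action of an oplax cocone on the morphisms of `W(X)`. -/
def mapAt {X : A} {x y : W.obj (op X)} (a : x ⟶ y) : legAt γ x ⟶ legAt γ y :=
  cellAt γ (𝟙 X) (a ≫ (W.mapId (op X)).inv.toNatTrans.app y) ≫ (λ_ (legAt γ y)).hom

lemma mapAt_id {X : A} (x : W.obj (op X)) : mapAt γ (𝟙 x) = 𝟙 (legAt γ x) := by
  rw [mapAt, ← cellAt_id]
  congr 2
  exact Category.id_comp _

/-- The left unitor of `g` is a 2-cell of `∫ W` from the vertical arrow of `a` followed by `(g, b)`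
to `(g, a ≫ b)`, and cocone cells respect composition and 2-cells. `cellAt_mapAt` is the mirror
image with the right unitor. -/
lemma mapAt_cellAt {X Y : A} (g : X ⟶ Y) {w x : W.obj (op X)} {y : W.obj (op Y)} (a : w ⟶ x)
    (b : x ⟶ (W.map g.op).toFunctor.obj y) :
    mapAt γ a ≫ cellAt γ g b = cellAt γ g (a ≫ b) := by
  have h := Elements.leftUnitor_w (⟨g, b⟩ : (⟨X, x⟩ : Elements W) ⟶ ⟨Y, y⟩)
  rw [mapAt, Category.assoc, ← leftUnitor_naturality, ← reassoc_of% (cellAt_comp γ (𝟙 X) g),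
    ← leftUnitor_whiskerRight, cellAt_map₂]
  congr 1
  simp only [Category.assoc]
  refine congrArg (a ≫ ·) (Eq.trans ?_ h)
  simp

lemma cellAt_mapAt {X Y : A} (g : X ⟶ Y) {x : W.obj (op X)} {y z : W.obj (op Y)}
    (a : x ⟶ (W.map g.op).toFunctor.obj y) (b : y ⟶ z) :
    cellAt γ g a ≫ g ◁ mapAt γ b = cellAt γ g (a ≫ (W.map g.op).toFunctor.map b) := by
  have h := Elements.rightUnitor_w
    (⟨g, a ≫ (W.map g.op).toFunctor.map b⟩ : (⟨X, x⟩ : Elements W) ⟶ ⟨Y, z⟩)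
  rw [mapAt, Bicategory.whiskerLeft_comp, ← reassoc_of% (cellAt_comp γ g (𝟙 Y)), triangle,
    cellAt_map₂]
  congr 1
  refine Eq.trans ?_ h
  simp

lemma mapAt_comp {X : A} {x y z : W.obj (op X)} (a : x ⟶ y) (b : y ⟶ z) :
    mapAt γ (a ≫ b) = mapAt γ a ≫ mapAt γ b := by
  rw [mapAt.eq_def γ (a ≫ b), mapAt.eq_def γ b, reassoc_of% (mapAt_cellAt γ), Category.assoc]

/-- The vertical-cartesian factorization: a cocone is determined by its legs, its vertical cells and
its cells at the arrows `(g, 𝟙)`. -/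
lemma cellAt_eq {X Y : A} (g : X ⟶ Y) {x : W.obj (op X)} {y : W.obj (op Y)}
    (a : x ⟶ (W.map g.op).toFunctor.obj y) :
    cellAt γ g a = mapAt γ a ≫ cellAt γ g (𝟙 _) := by
  rw [mapAt_cellAt, Category.comp_id]

lemma isIso_cell (hγ : IsSigma (M := delta W) γ) {X Y : Elements W} (f : X ⟶ Y)
    (hf : IsIso f.fiber) : IsIso (cell γ f) := by
  have := hγ f hf
  exact ((Cat.Hom.toNatIso (asIso (γ.naturality f.op))).app ⟨⟨⟩⟩).isIso_hom

lemma isSigma_of_isIso_cell (h : ∀ ⦃X Y : Elements W⦄ (f : X ⟶ Y), IsIso f.fiber →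
    IsIso (cell γ f)) : IsSigma (M := delta W) γ := by
  intro X Y f hf
  have h₁ : ∀ p, IsIso ((γ.naturality f.op).toNatTrans.app p) := by
    rintro ⟨⟨⟩⟩
    exact h f hf
  have h₂ := NatIso.isIso_of_isIso_app (γ.naturality f.op).toNatTrans
  exact (Cat.Hom.isoMk (asIso (γ.naturality f.op).toNatTrans)).isIso_hom

/-- The pseudonatural transformation `W ⟶ y(D)` that corresponds to a sigma natural
transformation. -/
noncomputable def toTrans (hγ : IsSigma (M := delta W) γ) : W ⟶ yoneda₀ D :=
  YonedaTrans.mk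
    (fun X =>
      { obj x := legAt γ x
        map a := mapAt γ a
        map_id x := mapAt_id γ x
        map_comp a b := mapAt_comp γ a b })
    -- The sigma condition enters here, and only at the cartesian arrows.
    (fun g x => @asIso _ _ _ _ (cellAt γ g (𝟙 _))
      (isIso_cell γ hγ _ (inferInstanceAs (IsIso (𝟙 _)))))
    (fun {X Y} g {x y} a => by
      refine (mapAt_cellAt γ g _ _).trans (Eq.trans ?_ (cellAt_mapAt γ g _ _).symm)
      rw [Category.id_comp, Category.comp_id])
    (fun {X Y g h} d x => by
      refine (mapAt_cellAt γ h _ _).trans (Eq.trans ?_ (cellAt_map₂ γ d _).symm)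
      rw [Category.id_comp, Category.comp_id])
    (fun {X} x => by
      refine congrArg (fun a => cellAt γ (𝟙 X) a ≫ (λ_ (legAt γ x)).hom) ?_
      exact (Cat.Hom.hom_inv_id_toNatTrans_app _ _).symm)
    (fun {X Y Z} f g z => by
      refine Eq.trans ?_ (congrArg (mapAt γ _ ≫ ·) (cellAt_comp γ f g _ _))
      refine Eq.trans ?_ ((Category.assoc _ _ _).symm.trans
        (congrArg (· ≫ (α_ f g (legAt γ z)).hom) (mapAt_cellAt γ (f ≫ g) _ _))).symm
      refine congrArg (fun a => cellAt γ (f ≫ g) a ≫ (α_ f g (legAt γ z)).hom) ?_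
      simp only [CategoryTheory.Functor.map_id, Category.id_comp]
      erw [Category.id_comp]
      exact (Cat.Hom.hom_inv_id_toNatTrans_app _ _).symm)

/-- Every sigma natural transformation comes from a pseudonatural transformation. -/
noncomputable def ofTransToTransIso (hγ : IsSigma (M := delta W) γ) :
    ofTrans (toTrans γ hγ) ≅ γ :=
  -- The legs agree on the nose, and the cells agree by the factorization `cellAt_eq`.
  isoMk (fun X => Iso.refl _) (fun {X Y} f => by
    have h := cellAt_eq γ f.base f.fiber
    refine (Category.id_comp _).trans (Eq.trans h ?_)
    change _ = _ ≫ f.base ◁ 𝟙 _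
    rw [Bicategory.whiskerLeft_id]
    exact (Category.comp_id _).symm)

end

lemma isSigma_ofTrans (θ : W ⟶ yoneda₀ D) : IsSigma (M := delta W) (ofTrans θ) := by
  refine isSigma_of_isIso_cell _ fun X Y f hf => ?_
  exact Iso.isIso_hom (((θ.app (op X.base)).toFunctor.mapIso (asIso f.fiber)) ≪≫
    YonedaTrans.nat θ f.base Y.fiber)

end Bicone

end Bisite

/-! ### The equivalence `Hom(W, y(D)) ≃ σ(Δ1, K(-, D))` and the theorem -/

namespace Bisite

open scoped Oplax.OplaxTrans Oplax.OplaxTrans.OplaxFunctor Pseudofunctor.StrongTrans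

variable {K : Type u} [Bicategory.{u, u} K]

/-- The functor from pseudonatural transformations `W ⟶ y(D)` to sigma natural transformations
`Δ1 ⟶ K(-, D)` on `∫ W`. -/
def transToSigma (W : Kᵒᵖ ⥤ᵖ Cat.{u, u}) (D : K) :
    (W ⟶ yoneda₀ D) ⥤ (sigmaBicocones (Elements.proj W).toPseudofunctor).obj D :=
  ObjectProperty.lift
    (IsSigma (M := delta W) (N := homInto (Elements.proj W).toPseudofunctor D))
    (Bicone.ofTransFunctor W D) Bicone.isSigma_ofTrans

instance (W : Kᵒᵖ ⥤ᵖ Cat.{u, u}) (D : K) : (transToSigma W D).IsEquivalence where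
  full :=
    { map_surjective m := by
        obtain ⟨n, hn⟩ := (Bicone.ofTransFunctor W D).map_surjective m.hom
        exact ⟨n, ObjectProperty.hom_ext _ hn⟩ }
  faithful :=
    { map_injective h :=
        (Bicone.ofTransFunctor W D).map_injective (congrArg (fun k => k.hom) h) }
  essSurj :=
    { mem_essImage γ := ⟨Bicone.toTrans γ.obj γ.property,
        ⟨ObjectProperty.isoMk _ (Bicone.ofTransToTransIso γ.obj γ.property)⟩⟩ }

/-- Evaluating sigma natural transformations at the one that corresponds to `θ : W ⟶ y(C)`
amounts to composing `θ` with `K(-, t)`. -/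
def evalTransToSigmaIso {W : Kᵒᵖ ⥤ᵖ Cat.{u, u}} {C : K} (θ : W ⟶ yoneda₀ C) (D : K) :
    evalFunctor (sigmaBicocones (Elements.proj W).toPseudofunctor)
      ((transToSigma W C).obj θ) D ≅
        postcomposing₂ C D ⋙ precomp (yoneda₀ D) θ ⋙ transToSigma W D :=
  NatIso.ofComponents
    (fun t => ObjectProperty.isoMk _ <|
      -- Both cocones have leg `θ(x) ≫ t` at `x`; their cells differ only by identities and by
      -- whiskering a composite in one step or in two.
      Bicone.isoMk (δ := Bicone.ofTrans (θ ≫ postcomp₂ t)) (fun X => Iso.refl _) (fun {X Y} f => by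
        have key {p q : X.base ⟶ C} {r : Y.base ⟶ C} (a : p ⟶ q) (b : q ⟶ f.base ≫ r) :
            𝟙 (p ≫ t) ≫ a ▷ t ≫ 𝟙 _ ≫ b ▷ t ≫ 𝟙 _ ≫ (α_ f.base r t).hom ≫ 𝟙 _ =
              (𝟙 _ ≫ (a ≫ b) ▷ t ≫ 𝟙 _ ≫ (α_ f.base r t).hom ≫ 𝟙 _) ≫
                f.base ◁ 𝟙 (r ≫ t) := by
          simp
        exact key (YonedaTrans.map θ f.fiber) (YonedaTrans.nat θ f.base Y.fiber).hom))
    (fun {s t} η => by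
      refine ObjectProperty.hom_ext _ (Bicone.hom_ext fun X => ?_)
      exact (Category.comp_id _).trans (Category.id_comp _).symm)

/-- The cocone of `S` is the universal one: evaluation at it is already pseudonatural in `D`, so
only its components need to be recognized as composites of equivalences. -/
theorem Bisieve.isSigmaBicolim_of_isEquivalence {C : K} (S : Bisieve C)
    (h : ∀ D : K, (precomp (yoneda₀ D) S.hom).IsEquivalence) : S.IsSigmaBicolim := by
  refine ⟨coyonedaTrans (sigmaBicocones (Elements.proj S.source).toPseudofunctor)
    ((transToSigma S.source C).obj S.hom), fun D => ?_⟩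
  have := h D
  have : (precomp (yoneda₀ D) S.hom ⋙ transToSigma S.source D).IsEquivalence :=
    Functor.isEquivalence_trans _ _
  have : (postcomposing₂ C D ⋙ precomp (yoneda₀ D) S.hom ⋙
      transToSigma S.source D).IsEquivalence := Functor.isEquivalence_trans _ _
  exact @Functor.isEquivalence_of_iso _ _ _ _ _ _ (evalTransToSigmaIso S.hom D).symm this

end Bisite

theorem theorem2 {K : Type u} [Bicategory.{u, u} K] [Bicategory.Strict K]
    (τ : Bisite.Bitopology K) (hτ : τ.IsSubcanonical)
    {C : K} (S : Bisite.Bisieve C) (hS : S ∈ τ.covering C) :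
    S.IsSigmaBicolim :=
  S.isSigmaBicolim_of_isEquivalence fun D => hτ D C S hS
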